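/- Let $B_n$ denote the open unit ball of $\mathbb{C}^n$ with the Euclidean norm. A map $\phi\colon B_2\to B_k$ is called *monomial of degree $d$* if each of its $k$ components is a monomial $C z_1^{a_1}z_2^{a_2}$ with $C\in\mathbb{C}$ (possibly $C=0$), and $d$ is the largest degree $a_1+a_2$ of a nonzero component (with $d=0$ if all components vanish). It is *proper* if the preimage of every compact subset of $B_k$ is a compact subset of $B_2$. For a polynomial $p$ let $\rho(p)$ be the number of distinct monomials that appear in $p$ with non-zero coefficient. 1. If $\phi\colon B_2\to B_k$ is a proper monomial map of degree $d$, then $d\le 2k-3$. 2. This is sharp: for every $k\ge 2$ there is a proper monomial map $B_2\to B_k$ of degree exactly $2k-3$. 3. (Homogeneous form.) Let $p\in\mathbb{R}[x_1,x_2,x_3]$ be homogeneous of degree $d$ with $p(0,0,x_3)=-(-x_3)^d$. Suppose that the polynomial $\tilde p$ defined by $p(x_1,x_2,-1)=\tilde p(x_1,x_2)-1$ has degree $d$ and only non-negative coefficients, and that $p=(x_1+x_2+x_3)\,q$ for some polynomial $q$. Then $\rho(p)\ge \frac{d+5}{2}$. 4. This is sharp: for every odd $d\geq 1$ there is a polynomial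 $p$ satisfying the hypotheses of part 3 with $\rho(p)=\frac{d+5}{2}$. -/

import Mathlib

/-- The open unit ball `B_n` of `ℂⁿ` (Euclidean norm), as a topological space. -/
abbrev UnitBall (n : ℕ) : Type :=
  Metric.ball (0 : EuclideanSpace ℂ (Fin n)) 1

/-- `φ : B_n → B_k` is a monomial mapping of degree `d`: its components are monomials
`C z^a` (with `C : ℂ`, possibly zero), and `d` is the largest degree of a component.
The polynomials `f i` are determined by `φ`. -/
def IsMonomialMapOfDegree {n k : ℕ} (φ : UnitBall n → UnitBall k) (d : ℕ) : Prop :=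
  ∃ f : Fin k → MvPolynomial (Fin n) ℂ,
    (∀ i, ∃ (a : Fin n →₀ ℕ) (C : ℂ), f i = MvPolynomial.monomial a C) ∧
    (∀ (z : UnitBall n) (i : Fin k),
      (φ z : EuclideanSpace ℂ (Fin k)) i =
        MvPolynomial.eval (fun j => (z : EuclideanSpace ℂ (Fin n)) j) (f i)) ∧
    Finset.univ.sup (fun i => (f i).totalDegree) = d

/-- The polynomial `p̃ ∈ ℝ[x₁, x₂]` defined by `p(x₁, x₂, -1) = p̃(x₁, x₂) - 1`. -/
noncomputable def tildePoly (p : MvPolynomial (Fin 3) ℝ) : MvPolynomial (Fin 2) ℝ :=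
  MvPolynomial.aeval ![MvPolynomial.X 0, MvPolynomial.X 1, -1] p + 1

/-- The hypotheses of the homogeneous form of the degree estimate, in three variables:
`p` is the homogenization, with `x₃` replaced by `-x₃`, of `p̃ - 1`, where `p̃` is a polynomial
of degree `d` with non-negative coefficients and no constant term, and `p` is a multiple of
`s = x₁ + x₂ + x₃`. -/
structure IsHomogForm (d : ℕ) (p : MvPolynomial (Fin 3) ℝ) : Prop where
  homogeneous : p.IsHomogeneous d
  eval_last : ∀ t : ℝ, MvPolynomial.eval ![0, 0, t] p = -(-t) ^ d
  coeff_nonneg : ∀ a, 0 ≤ (tildePoly p).coeff a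
  totalDegree_tilde : (tildePoly p).totalDegree = d
  dvd : ∃ q : MvPolynomial (Fin 3) ℝ,
    p = (MvPolynomial.X 0 + MvPolynomial.X 1 + MvPolynomial.X 2) * q

/-- `ρ(p)`: the number of distinct monomials appearing in `p` with non-zero coefficient. -/
def monomialRank {σ : Type*} (p : MvPolynomial σ ℝ) : ℕ := p.support.card

/-! The squared norm of a monomial map is a polynomial `f` in x = |z₁|², y = |z₂|² with non-negative
coefficients and at most k monomials. Properness sends the sphere to the sphere, so f = 1 on the
segment x + y = 1 with x, y ≥ 0, and f - 1 = (x + y - 1) q. It remains to bound the degree by the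
number of monomials (`totalDegree_add_three_le`).

Arrange the coefficients of q and f - 1 in triangles Q and P, one row per degree. Each entry of P is
a signed sum of at most three adjacent entries of Q. Give every entry of Q a sign, choosing signs
for the zeros so that the signs can force an entry of P to be nonzero (`filledSign`,
`count_nonzero_of_convolution`). A telescoping sum of products of neighbouring signs then bounds the
nonzero entries of P from below, with interior entries counted twice and side entries once
(`weighted_count_of_signs`). Each of the three sides of P has at least two nonzero entries, and
counting the sides once more gives 2 · #P ≥ (d - 1) + 6 = d + 5. Discarding the constant term of f -
1 gives d + 3 ≤ 2 · #f.

For sharpness, Lucas polynomials give, in odd degree d, a multiple of x₁ + x₂ + x₃ with at most (d +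
5)/2 monomials. Square roots of the coefficients of its dehomogenization define a proper monomial
map. -/

/-! ### Sign patterns and counting in triangular arrays -/

/-- The indicator of a nonzero real number, with values in `ℤ`. -/
noncomputable def nonzeroInd (r : ℝ) : ℤ := if r = 0 then 0 else 1

lemma nonzeroInd_nonneg (r : ℝ) : 0 ≤ nonzeroInd r := by
  unfold nonzeroInd; split_ifs <;> simp

lemma nonzeroInd_of_ne {r : ℝ} (h : r ≠ 0) : nonzeroInd r = 1 := if_neg h

/-- Two distinct nonzero entries of a finite sequence force the number of its nonzero entries to be
at least two. -/
lemma two_le_sum_nonzeroInd {n i j : ℕ} {g : ℕ → ℝ} (hi : i < n) (hj : j < n) (hij : i ≠ j)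
    (gi : g i ≠ 0) (gj : g j ≠ 0) : 2 ≤ ∑ m ∈ Finset.range n, nonzeroInd (g m) := by
  have h : ∑ m ∈ ({i, j} : Finset ℕ), nonzeroInd (g m) ≤
      ∑ m ∈ Finset.range n, nonzeroInd (g m) := by
    apply Finset.sum_le_sum_of_subset_of_nonneg
    · intro x hx
      simp only [Finset.mem_insert, Finset.mem_singleton] at hx
      rcases hx with rfl | rfl <;> simpa
    · intro x _ _
      exact nonzeroInd_nonneg _
  rw [Finset.sum_pair hij, nonzeroInd_of_ne gi, nonzeroInd_of_ne gj] at h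
  linarith

/-- If every positive entry of an array has a positive neighbour in the previous row, then every row
before a row with a positive entry has a positive entry. -/
lemma exists_positive_in_rows {Q : ℕ → ℕ → ℝ} (h0 : ∀ m, 0 < Q (m + 1) 0 → 0 < Q m 0)
    (hs : ∀ m a, 0 < Q (m + 1) (a + 1) → 0 < Q m a ∨ 0 < Q m (a + 1)) {n : ℕ}
    (hn : ∃ a, 0 < Q n a) {m : ℕ} (hm : m ≤ n) : ∃ a, 0 < Q m a := by
  induction hm using Nat.decreasingInduction with
  | self => exact hn
  | of_succ m _ ih =>
    obtain ⟨a, ha⟩ := ih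
    cases a with
    | zero => exact ⟨0, h0 m ha⟩
    | succ a =>
      rcases hs m a ha with h | h
      · exact ⟨a, h⟩
      · exact ⟨a + 1, h⟩

/-- The sign of the entry `Q m a`; zero entries get alternating signs, with a different pattern on
the two sides of the entries `Q m (x m)`. -/
noncomputable def filledSign (Q : ℕ → ℕ → ℝ) (x : ℕ → ℕ) (m a : ℕ) : ℤ :=
  if 0 < Q m a then 1 else if Q m a < 0 then -1 else
    if a < x m then (-1) ^ a else (-1) ^ (m + a)

lemma filledSign_eq_or (Q : ℕ → ℕ → ℝ) (x : ℕ → ℕ) (m a : ℕ) :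
    filledSign Q x m a = 1 ∨ filledSign Q x m a = -1 := by
  unfold filledSign
  split_ifs
  · simp
  · simp
  · exact neg_one_pow_eq_or ℤ a
  · exact neg_one_pow_eq_or ℤ (m + a)

lemma filledSign_cases (Q : ℕ → ℕ → ℝ) (x : ℕ → ℕ) (m a : ℕ) :
    (0 < Q m a ∧ filledSign Q x m a = 1) ∨ (Q m a < 0 ∧ filledSign Q x m a = -1) ∨
      (Q m a = 0 ∧ filledSign Q x m a = if a < x m then (-1) ^ a else (-1) ^ (m + a)) := by
  unfold filledSign
  rcases lt_trichotomy (Q m a) 0 with h | h | h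
  · simp [h, h.le]
  · simp [h]
  · simp [h]

lemma filledSign_of_zero {Q : ℕ → ℕ → ℝ} {m a : ℕ} (x : ℕ → ℕ) (h : Q m a = 0) :
    filledSign Q x m a = if a < x m then (-1) ^ a else (-1) ^ (m + a) := by
  simp [filledSign, h]

lemma nonneg_of_filledSign {Q : ℕ → ℕ → ℝ} {x : ℕ → ℕ} {m a : ℕ} (h : filledSign Q x m a = 1) :
    0 ≤ Q m a := by
  by_contra! hc
  simp [filledSign, hc, hc.le] at h

lemma nonpos_of_filledSign {Q : ℕ → ℕ → ℝ} {x : ℕ → ℕ} {m a : ℕ} (h : filledSign Q x m a = -1) :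
    Q m a ≤ 0 := by
  by_contra! hc
  simp [filledSign, hc] at h

/-- Horizontal neighbours that both vanish get opposite signs. -/
lemma filledSign_succ_of_zero {Q : ℕ → ℕ → ℝ} {x : ℕ → ℕ} {m a : ℕ} (hx : 0 < Q m (x m))
    (h : Q m a = 0) (h' : Q m (a + 1) = 0) :
    filledSign Q x m (a + 1) = -filledSign Q x m a := by
  have h1 : a + 1 ≠ x m := by rintro e; rw [e] at h'; exact hx.ne' h'
  rw [filledSign_of_zero x h, filledSign_of_zero x h']
  by_cases hlt : a < x m
  · rw [if_pos hlt, if_pos (by omega), pow_succ]; ring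
  · rw [if_neg hlt, if_neg (by omega), ← add_assoc, pow_succ]; ring

/-- The count of nonzero entries in the interior (with multiplicity two) and on the boundary of the
triangular array `P`, in terms of a compatible choice of signs. -/
lemma weighted_count_of_signs {n : ℕ} {s : ℕ → ℕ → ℤ} {P : ℕ → ℕ → ℝ}
    (hs : ∀ m a, s m a = 1 ∨ s m a = -1)
    (hint : ∀ m < n, ∀ a < m, s m a * s m (a + 1) - s m a * s (m + 1) (a + 1)
      - s m (a + 1) * s (m + 1) (a + 1) ≤ -1 + 4 * nonzeroInd (P (m + 1) (a + 1)))
    (hleft : ∀ m < n, -(s m 0 * s (m + 1) 0) ≤ -1 + 2 * nonzeroInd (P (m + 1) 0))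
    (hright : ∀ m < n, -(s m m * s (m + 1) (m + 1)) ≤ -1 + 2 * nonzeroInd (P (m + 1) (m + 1)))
    (htop : ∀ a < n, s n a * s n (a + 1) ≤ -1 + 2 * nonzeroInd (P (n + 1) (a + 1))) :
    (n : ℤ) ≤ ∑ m ∈ Finset.range n, (2 * ∑ a ∈ Finset.range m, nonzeroInd (P (m + 1) (a + 1))
        + nonzeroInd (P (m + 1) 0) + nonzeroInd (P (m + 1) (m + 1)))
      + ∑ a ∈ Finset.range n, nonzeroInd (P (n + 1) (a + 1)) := by
  -- `h m` is the sum of products of horizontally adjacent signs in row m; it telescopes over the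
  -- rows.
  set h : ℕ → ℤ := fun m => ∑ a ∈ Finset.range m, s m a * s m (a + 1) with hh
  have hrow : ∀ m < n, 1 + h m - h (m + 1) ≤
      2 * (2 * ∑ a ∈ Finset.range m, nonzeroInd (P (m + 1) (a + 1))
        + nonzeroInd (P (m + 1) 0) + nonzeroInd (P (m + 1) (m + 1))) := by
    intro m hm
    -- Two entries of row m and the one below them: the expression is 3 if the two upper signs agree
    -- and the lower one differs, and -1 otherwise.
    have hA : ∑ a ∈ Finset.range m, (s m a * s m (a + 1) - s m a * s (m + 1) (a + 1)
        - s m (a + 1) * s (m + 1) (a + 1)) ≤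
        ∑ a ∈ Finset.range m, (-1 + 4 * nonzeroInd (P (m + 1) (a + 1))) :=
      Finset.sum_le_sum fun a ha => hint m hm a (Finset.mem_range.1 ha)
    -- The complementary triangles, with two entries in row m + 1, satisfy the bound -1 for any
    -- signs. There is one more of them, and their cross terms are those of `hA` plus the two on the
    -- sides.
    have hB : ∑ _a ∈ Finset.range (m + 1), (-1 : ℤ) ≤ ∑ a ∈ Finset.range (m + 1),
        (s (m + 1) a * s (m + 1) (a + 1) - s m a * s (m + 1) a - s m a * s (m + 1) (a + 1)) := by
      refine Finset.sum_le_sum fun a _ => ?_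
      rcases hs m a with e1 | e1 <;> rcases hs (m + 1) a with e2 | e2 <;>
        rcases hs (m + 1) (a + 1) with e3 | e3 <;> simp [e1, e2, e3]
    have hU1 := Finset.sum_range_succ (fun a => s m a * s (m + 1) (a + 1)) m
    have hU2 := Finset.sum_range_succ' (fun a => s m a * s (m + 1) a) m
    simp only [Finset.sum_sub_distrib, Finset.sum_add_distrib, Finset.sum_const, Finset.card_range,
      ← Finset.mul_sum, nsmul_eq_mul] at hA hB
    have hl := hleft m hm
    have hr := hright m hm
    push_cast at hB
    simp only [hh]
    linarith
  have hsum := Finset.sum_le_sum fun m hm => hrow m (Finset.mem_range.1 hm)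
  have htel : ∑ m ∈ Finset.range n, (1 + h m - h (m + 1)) = n + h 0 - h n := by
    have := Finset.sum_range_sub' h n
    have e : ∀ m, 1 + h m - h (m + 1) = 1 + (h m - h (m + 1)) := fun m => by ring
    simp only [e, Finset.sum_add_distrib, this]
    simp; ring
  have ht : h n ≤ ∑ a ∈ Finset.range n, (-1 + 2 * nonzeroInd (P (n + 1) (a + 1))) :=
    Finset.sum_le_sum fun a ha => htop a (Finset.mem_range.1 ha)
  have hz : h 0 = 0 := by simp [hh]
  rw [htel, ← Finset.mul_sum] at hsum
  simp only [Finset.sum_add_distrib, Finset.sum_const, Finset.card_range, ← Finset.mul_sum,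
      nsmul_eq_mul] at ht
  linarith

/-- The number of nonzero entries of a triangular array split into interior, sides and corners. -/
lemma two_mul_sum_triangle (I : ℕ → ℕ → ℤ) (n : ℕ) :
    2 * ∑ m ∈ Finset.range (n + 2), ∑ a ∈ Finset.range (m + 1), I m a =
      ∑ m ∈ Finset.range n, (2 * ∑ a ∈ Finset.range m, I (m + 1) (a + 1)
        + I (m + 1) 0 + I (m + 1) (m + 1))
      + ∑ a ∈ Finset.range n, I (n + 1) (a + 1)
      + ∑ m ∈ Finset.range (n + 2), I m 0 + ∑ m ∈ Finset.range (n + 2), I m m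
      + ∑ a ∈ Finset.range (n + 2), I (n + 1) a := by
  have hrow : ∀ m, ∑ a ∈ Finset.range (m + 1 + 1), I (m + 1) a =
      ∑ a ∈ Finset.range m, I (m + 1) (a + 1) + I (m + 1) 0 + I (m + 1) (m + 1) := by
    intro m
    rw [Finset.sum_range_succ, Finset.sum_range_succ']
  have hside : ∀ g : ℕ → ℤ, ∑ m ∈ Finset.range (n + 2), g m =
      ∑ m ∈ Finset.range n, g (m + 1) + g 0 + g (n + 1) := by
    intro g
    rw [Finset.sum_range_succ, Finset.sum_range_succ']
  rw [hside (fun m => ∑ a ∈ Finset.range (m + 1), I m a), hside (fun m => I m 0),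
    hside (fun m => I m m), hside (fun a => I (n + 1) a)]
  simp only [hrow, Finset.sum_add_distrib, ← Finset.mul_sum, zero_add, Finset.sum_range_one]
  ring

/-- A lower bound for the number of nonzero entries of a triangular array `P` that arises from a
smaller triangular array `Q` by convolution with `x + y - 1` and has non-negative entries outside
the apex. -/
theorem count_nonzero_of_convolution {d : ℕ} {Q P : ℕ → ℕ → ℝ} (hd : 1 ≤ d) (hQ0 : 0 < Q 0 0)
    (hQa : ∀ m a, m < a → Q m a = 0) (hQd : ∀ m a, d ≤ m → Q m a = 0)
    (hP00 : P 0 0 ≠ 0) (hP0 : ∀ m, P (m + 1) 0 = Q m 0 - Q (m + 1) 0)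
    (hPs : ∀ m a, P (m + 1) (a + 1) = Q m a + Q m (a + 1) - Q (m + 1) (a + 1))
    (hPn : ∀ m a, 0 ≤ P (m + 1) a) (htop : ∃ a, P d a ≠ 0) :
    (d : ℤ) + 5 ≤
      2 * ∑ m ∈ Finset.range (d + 1), ∑ a ∈ Finset.range (m + 1), nonzeroInd (P m a) := by
  obtain ⟨n, rfl⟩ : ∃ n, d = n + 1 := ⟨d - 1, by omega⟩
  -- a nonzero entry in the last row of `Q`
  have hex : ∃ a, Q n a ≠ 0 := by
    by_contra! hall
    obtain ⟨a, ha⟩ := htop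
    apply ha
    cases a with
    | zero => rw [hP0, hall, hQd _ _ le_rfl, sub_zero]
    | succ a => rw [hPs, hall, hall, hQd _ _ le_rfl]; simp
  classical
  -- the first nonzero entry there is positive
  obtain ⟨a₀, ha₀, hPa₀⟩ : ∃ a₀, 0 < Q n a₀ ∧ P (n + 1) a₀ = Q n a₀ := by
    have hfind := Nat.find_spec hex
    have hmin := fun b => @Nat.find_min _ _ hex b
    have hP : P (n + 1) (Nat.find hex) = Q n (Nat.find hex) := by
      revert hmin
      cases Nat.find hex with
      | zero => intro _; rw [hP0, hQd _ _ le_rfl, sub_zero]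
      | succ b =>
        intro hmin
        have := hmin b (Nat.lt_succ_self b)
        rw [hPs, hQd _ _ le_rfl, not_not.1 this]; simp
    exact ⟨Nat.find hex, lt_of_le_of_ne (hP ▸ hPn _ _) (Ne.symm hfind), hP⟩
  have ha₀n : a₀ ≤ n := by
    by_contra h
    exact ha₀.ne' (hQa _ _ (by omega))
  -- Since P ≥ 0 below the apex, a positive entry of Q needs a positive entry among its neighbours
  -- in the row before, so positivity climbs from the last row. The implication sits inside the
  -- quantifier so that `choose` gives a total `x`; its values beyond row n are irrelevant.
  have hrows : ∀ m, ∃ a, m ≤ n → 0 < Q m a := by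
    intro m
    by_cases hm : m ≤ n
    · obtain ⟨a, ha⟩ := exists_positive_in_rows
        (fun m h => by have := hPn m 0; rw [hP0] at this; linarith)
        (fun m a h => by
          have := hPn m (a + 1)
          rw [hPs] at this
          by_contra! hc
          linarith [hc.1, hc.2]) ⟨a₀, ha₀⟩ hm
      exact ⟨a, fun _ => ha⟩
    · exact ⟨0, fun h => absurd h hm⟩
  choose x hxp using hrows
  have hxle : ∀ m ≤ n, x m ≤ m := by
    intro m hm
    by_contra h
    exact (hxp m hm).ne' (hQa _ _ (by omega))
  have hcount := weighted_count_of_signs (n := n) (s := filledSign Q x) (P := P)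
    (filledSign_eq_or Q x) ?_ ?_ ?_ ?_
  -- The apex is one nonzero entry. If there were no other on this side, Q would be constant along
  -- it, yet Q starts positive and vanishes in row n + 1.
  · have hleft : 2 ≤ ∑ m ∈ Finset.range (n + 2), nonzeroInd (P m 0) := by
      obtain ⟨m, hm, hPm⟩ : ∃ m ≤ n, P (m + 1) 0 ≠ 0 := by
        by_contra! hall
        have : ∀ m ≤ n + 1, Q m 0 = Q 0 0 := by
          intro m
          induction m with
          | zero => simp
          | succ m ih =>
            intro hm
            have := hall m (by omega)
            rw [hP0, ih (by omega)] at this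
            linarith
        have h := this (n + 1) le_rfl
        rw [hQd _ _ le_rfl] at h
        exact hQ0.ne h
      exact two_le_sum_nonzeroInd (g := fun m => P m 0) (i := 0) (j := m + 1) (by omega) (by omega)
        (by omega) hP00 hPm
    have hright : 2 ≤ ∑ m ∈ Finset.range (n + 2), nonzeroInd (P m m) := by
      obtain ⟨m, hm, hPm⟩ : ∃ m ≤ n, P (m + 1) (m + 1) ≠ 0 := by
        by_contra! hall
        have : ∀ m ≤ n + 1, Q m m = Q 0 0 := by
          intro m
          induction m with
          | zero => simp
          | succ m ih =>
            intro hm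
            have := hall m (by omega)
            rw [hPs, ih (by omega), hQa m (m + 1) (by omega)] at this
            linarith
        have h := this (n + 1) le_rfl
        rw [hQd _ _ le_rfl] at h
        exact hQ0.ne h
      exact two_le_sum_nonzeroInd (g := fun m => P m m) (i := 0) (j := m + 1) (by omega) (by omega)
        (by omega) hP00 hPm
    -- `a₀` gives one nonzero entry. If all later ones vanished, the entries of row n of Q would
    -- alternate from `a₀` on without ever becoming zero.
    have hlast : 2 ≤ ∑ a ∈ Finset.range (n + 2), nonzeroInd (P (n + 1) a) := by
      obtain ⟨b, hb, hbn, hPb⟩ : ∃ b, a₀ ≤ b ∧ b ≤ n ∧ P (n + 1) (b + 1) ≠ 0 := by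
        by_contra! hall
        have : ∀ b, a₀ ≤ b → b ≤ n + 1 → Q n b ≠ 0 := by
          intro b hb
          induction b, hb using Nat.le_induction with
          | base => exact fun _ => ha₀.ne'
          | succ b hb ih =>
            intro hbn h0
            have := hall b hb (by omega)
            rw [hPs, h0, hQd _ _ le_rfl] at this
            exact ih (by omega) (by linarith)
        exact this (n + 1) (by omega) le_rfl (hQa _ _ (by omega))
      exact two_le_sum_nonzeroInd (g := fun a => P (n + 1) a) (i := a₀) (j := b + 1) (by omega)
        (by omega) (by omega) (hPa₀ ▸ ha₀.ne') hPb
    have hsplit := two_mul_sum_triangle (fun m a => nonzeroInd (P m a)) n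
    rw [show n + 1 + 1 = n + 2 from rfl, hsplit]
    push_cast
    linarith
  · intro m hm a ha
    have hP := hPs m a
    by_cases h0 : P (m + 1) (a + 1) = 0
    · rw [h0] at hP
      -- When P vanishes, the exceptional sign pattern gives Q m a, Q m (a + 1) and -Q (m + 1) (a +
      -- 1) the same weak sign and sum 0, so all vanish. But adjacent zeros carry opposite signs.
      have hzero : ¬ (Q m a = 0 ∧ Q m (a + 1) = 0 ∧
          filledSign Q x m a = filledSign Q x m (a + 1)) := by
        rintro ⟨q1, q2, e⟩
        rw [filledSign_succ_of_zero (hxp m hm.le) q1 q2] at e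
        rcases filledSign_eq_or Q x m a with f | f <;> rw [f] at e <;> norm_num at e
      rw [h0, show nonzeroInd 0 = 0 from if_pos rfl]
      rcases filledSign_eq_or Q x m a with f1 | f1 <;>
      rcases filledSign_eq_or Q x m (a + 1) with f2 | f2 <;>
      rcases filledSign_eq_or Q x (m + 1) (a + 1) with f3 | f3 <;>
      first
      | (rw [f1, f2, f3]; norm_num; done)
      | (exfalso
         have q1 := nonneg_of_filledSign f1
         have q2 := nonneg_of_filledSign f2
         have q3 := nonpos_of_filledSign f3
         exact hzero ⟨by linarith, by linarith, f1.trans f2.symm⟩)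
      | (exfalso
         have q1 := nonpos_of_filledSign f1
         have q2 := nonpos_of_filledSign f2
         have q3 := nonneg_of_filledSign f3
         exact hzero ⟨by linarith, by linarith, f1.trans f2.symm⟩)
    · rw [nonzeroInd_of_ne h0]
      rcases filledSign_eq_or Q x m a with f1 | f1 <;>
      rcases filledSign_eq_or Q x m (a + 1) with f2 | f2 <;>
      rcases filledSign_eq_or Q x (m + 1) (a + 1) with f3 | f3 <;> simp [f1, f2, f3]
  · intro m hm
    have hP := hP0 m
    by_cases h0 : P (m + 1) 0 = 0
    · rw [h0] at hP
      -- A zero in column 0 lies left of `x m`, so its sign is (-1)^0 = 1 in every row, and equal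
      -- boundary entries get equal signs.
      have hz : Q m 0 = 0 → filledSign Q x m 0 = 1 := by
        intro h
        have : x m ≠ 0 := by intro e; have := hxp m hm.le; rw [e, h] at this; exact this.false
        rw [filledSign_of_zero x h, if_pos (by omega), pow_zero]
      have hz' : Q (m + 1) 0 = 0 → filledSign Q x (m + 1) 0 = 1 := by
        intro h
        have : x (m + 1) ≠ 0 := by intro e; have := hxp (m + 1) hm; rw [e, h] at this; exact this.false
        rw [filledSign_of_zero x h, if_pos (by omega), pow_zero]
      rcases filledSign_cases Q x m 0 with ⟨q1, e1⟩ | ⟨q1, e1⟩ | ⟨q1, -⟩ <;>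
      rcases filledSign_cases Q x (m + 1) 0 with ⟨q2, e2⟩ | ⟨q2, e2⟩ | ⟨q2, -⟩ <;>
      first
      | (exfalso; linarith)
      | (rw [hz q1, hz' q2]; simp [h0, nonzeroInd])
      | (rw [e1, e2]; simp [h0, nonzeroInd])
    · rw [nonzeroInd_of_ne h0]
      rcases filledSign_eq_or Q x m 0 with f1 | f1 <;>
      rcases filledSign_eq_or Q x (m + 1) 0 with f2 | f2 <;> simp [f1, f2]
  · intro m hm
    have hP := hPs m m
    rw [hQa m (m + 1) (by omega)] at hP
    by_cases h0 : P (m + 1) (m + 1) = 0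
    · rw [h0] at hP
      -- A zero on the diagonal lies right of `x m`, where the sign is (-1)^(m + m) = 1; this is why
      -- m enters the exponent there.
      have hz : ∀ m ≤ n, Q m m = 0 → filledSign Q x m m = 1 := by
        intro m hm h
        rw [filledSign_of_zero x h, if_neg (by have := hxle m hm; omega), ← two_mul, pow_mul]
        simp
      rcases filledSign_cases Q x m m with ⟨q1, e1⟩ | ⟨q1, e1⟩ | ⟨q1, -⟩ <;>
      rcases filledSign_cases Q x (m + 1) (m + 1) with ⟨q2, e2⟩ | ⟨q2, e2⟩ | ⟨q2, -⟩ <;>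
      first
      | (exfalso; linarith)
      | (rw [hz _ hm.le q1, hz _ hm q2]; simp [h0, nonzeroInd])
      | (rw [e1, e2]; simp [h0, nonzeroInd])
    · rw [nonzeroInd_of_ne h0]
      rcases filledSign_eq_or Q x m m with f1 | f1 <;>
      rcases filledSign_eq_or Q x (m + 1) (m + 1) with f2 | f2 <;> simp [f1, f2]
  · intro a ha
    have hP := hPs n a
    rw [hQd (n + 1) _ le_rfl] at hP
    by_cases h0 : P (n + 1) (a + 1) = 0
    · rw [h0] at hP
      rcases filledSign_cases Q x n a with ⟨q1, e1⟩ | ⟨q1, e1⟩ | ⟨q1, -⟩ <;>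
      rcases filledSign_cases Q x n (a + 1) with ⟨q2, e2⟩ | ⟨q2, e2⟩ | ⟨q2, -⟩ <;>
      first
      | (exfalso; linarith)
      | (rw [filledSign_succ_of_zero (hxp n le_rfl) q1 q2]
         rcases filledSign_eq_or Q x n a with e1 | e1 <;> simp [e1, h0, nonzeroInd])
      | (rw [e1, e2]; simp [h0, nonzeroInd])
    · rw [nonzeroInd_of_ne h0]
      rcases filledSign_eq_or Q x n a with f1 | f1 <;>
      rcases filledSign_eq_or Q x n (a + 1) with f2 | f2 <;> simp [f1, f2]

/-! ### Polynomials congruent to 1 modulo x + y - 1 -/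

/-- The exponent of the monomial `x ^ a * y ^ b` in two variables. -/
noncomputable def expPair (a b : ℕ) : Fin 2 →₀ ℕ := Finsupp.single 0 a + Finsupp.single 1 b

lemma expPair_apply_zero (a b : ℕ) : expPair a b 0 = a := by simp [expPair]

lemma expPair_apply_one (a b : ℕ) : expPair a b 1 = b := by simp [expPair]

lemma expPair_eta (e : Fin 2 →₀ ℕ) : expPair (e 0) (e 1) = e := by
  ext i; fin_cases i <;> simp [expPair]

lemma degree_expPair (a b : ℕ) : (expPair a b).degree = a + b := by
  simp [expPair]

lemma expPair_eq_zero {a b : ℕ} : expPair a b = 0 ↔ a = 0 ∧ b = 0 := by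
  rw [← Finsupp.degree_eq_zero_iff, degree_expPair]; omega

section LinearFactor

variable {q : MvPolynomial (Fin 2) ℝ}

open MvPolynomial

lemma coeff_X_zero_mul_expPair_succ (a b : ℕ) :
    coeff (expPair (a + 1) b) (X 0 * q) = coeff (expPair a b) q := by
  rw [← coeff_X_mul (expPair a b) 0 q, expPair, expPair, Finsupp.single_add]
  congr 1
  abel

lemma coeff_X_one_mul_expPair_succ (a b : ℕ) :
    coeff (expPair a (b + 1)) (X 1 * q) = coeff (expPair a b) q := by
  rw [← coeff_X_mul (expPair a b) 1 q, expPair, expPair, Finsupp.single_add]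
  congr 1
  abel

lemma coeff_X_zero_mul_expPair_zero (b : ℕ) : coeff (expPair 0 b) (X 0 * q) = 0 := by
  rw [coeff_X_mul', if_neg]
  simp [expPair]

lemma coeff_X_one_mul_expPair_zero (a : ℕ) : coeff (expPair a 0) (X 1 * q) = 0 := by
  rw [coeff_X_mul', if_neg]
  simp [expPair]

lemma coeff_linear_mul (e : Fin 2 →₀ ℕ) : coeff e ((X 0 + X 1 - 1) * q) =
    coeff e (X 0 * q) + coeff e (X 1 * q) - coeff e q := by
  rw [sub_mul, add_mul, one_mul, coeff_sub, coeff_add]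

lemma one_le_totalDegree_linear :
    1 ≤ (X 0 + X 1 - 1 : MvPolynomial (Fin 2) ℝ).totalDegree := by
  have h : expPair 1 0 ∈ (X 0 + X 1 - 1 : MvPolynomial (Fin 2) ℝ).support := by
    have := coeff_linear_mul (q := 1) (expPair 1 0)
    rw [mul_one, coeff_X_zero_mul_expPair_succ, coeff_X_one_mul_expPair_zero] at this
    rw [mem_support_iff, this]
    simp [coeff_one, eq_comm (a := (0 : Fin 2 →₀ ℕ)), expPair_eq_zero]
  have := le_totalDegree h
  change (expPair 1 0).degree ≤ _ at this
  rwa [degree_expPair] at this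

/-- The number of nonzero coefficients up to degree `d` is at most the number of monomials. -/
lemma sum_nonzeroInd_coeff_le_card_support (g : MvPolynomial (Fin 2) ℝ) (d : ℕ) :
    ∑ m ∈ Finset.range (d + 1), ∑ a ∈ Finset.range (m + 1),
      nonzeroInd (coeff (expPair a (m - a)) g) ≤ g.support.card := by
  classical
  rw [Finset.sum_sigma']
  have h : ∀ r : ℝ, nonzeroInd r = if r ≠ 0 then 1 else 0 := fun r => by
    by_cases hr : r = 0 <;> simp [nonzeroInd, hr]
  simp only [h, Finset.sum_boole]
  norm_cast
  refine Finset.card_le_card_of_injOn (fun z => expPair z.2 (z.1 - z.2)) ?_ ?_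
  · intro z hz
    simp only [Finset.coe_filter, Set.mem_ofPred_eq] at hz
    exact mem_support_iff.2 hz.2
  · rintro ⟨m, a⟩ hz ⟨m', a'⟩ hz' heq
    simp only [Finset.coe_filter, Set.mem_ofPred_eq, Finset.mem_sigma, Finset.mem_range] at hz hz'
    have h0 := DFunLike.congr_fun heq 0
    have h1 := DFunLike.congr_fun heq 1
    simp only [expPair_apply_zero, expPair_apply_one] at h0 h1
    obtain rfl : a = a' := h0
    obtain rfl : m = m' := by omega
    rfl

/-- The degree estimate for polynomials with non-negative coefficients that are constant on the line
`x + y = 1`. -/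
theorem totalDegree_add_three_le {f : MvPolynomial (Fin 2) ℝ} (hpos : ∀ e, 0 ≤ coeff e f)
    (h0 : coeff 0 f < 1) (hdvd : X 0 + X 1 - 1 ∣ f - 1) :
    f.totalDegree + 3 ≤ 2 * f.support.card := by
  classical
  obtain ⟨q, hq⟩ := hdvd
  set d := f.totalDegree with hd
  have hcoeff : ∀ e, e ≠ 0 → coeff e (f - 1) = coeff e f := by
    intro e he
    rw [coeff_sub, coeff_one, if_neg (Ne.symm he), sub_zero]
  have hcoeff0 : coeff 0 (f - 1) = coeff 0 f - 1 := by simp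
  have hne : f - 1 ≠ 0 := by
    intro h
    rw [h, coeff_zero] at hcoeff0
    linarith
  have hq0 : q ≠ 0 := by rintro rfl; exact hne (by rw [hq, mul_zero])
  have hl0 : (X 0 + X 1 - 1 : MvPolynomial (Fin 2) ℝ) ≠ 0 := by
    intro h; exact hne (by rw [hq, h, zero_mul])
  -- Degrees add in a domain, so q has degree below d and Q has no nonzero row from d on.
  have hdeg : q.totalDegree + 1 ≤ d := by
    have h1 : (f - 1).totalDegree ≤ d := by
      simpa using totalDegree_sub f 1
    rw [hq, totalDegree_mul_of_isDomain hl0 hq0] at h1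
    have := one_le_totalDegree_linear
    omega
  have hd1 : 1 ≤ d := by omega
  set Q : ℕ → ℕ → ℝ := fun m a => if a ≤ m then coeff (expPair a (m - a)) q else 0 with hQ
  set P : ℕ → ℕ → ℝ := fun m a => if a ≤ m then coeff (expPair a (m - a)) (f - 1) else 0 with hP
  have hPQ : coeff 0 (f - 1) = -coeff 0 q := by
    have hz : (0 : Fin 2 →₀ ℕ) = expPair 0 0 := (expPair_eq_zero.2 ⟨rfl, rfl⟩).symm
    rw [hq, coeff_linear_mul, hz, coeff_X_zero_mul_expPair_zero, coeff_X_one_mul_expPair_zero]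
    simp
  have hz : expPair 0 0 = 0 := expPair_eq_zero.2 ⟨rfl, rfl⟩
  have key := count_nonzero_of_convolution (d := d) (Q := Q) (P := P) hd1 ?_ ?_ ?_ ?_ ?_ ?_ ?_ ?_
  · have hsum : ∑ m ∈ Finset.range (d + 1), ∑ a ∈ Finset.range (m + 1), nonzeroInd (P m a) =
        ∑ m ∈ Finset.range (d + 1), ∑ a ∈ Finset.range (m + 1),
          nonzeroInd (coeff (expPair a (m - a)) (f - 1)) := by
      refine Finset.sum_congr rfl fun m _ => Finset.sum_congr rfl fun a ha => ?_
      rw [hP]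
      simp only
      rw [if_pos (by have := Finset.mem_range.1 ha; omega)]
    have hle := sum_nonzeroInd_coeff_le_card_support (f - 1) d
    have hsub : (f - 1).support ⊆ insert 0 f.support := by
      intro e he
      by_cases h : e = 0
      · simp [h]
      · rw [mem_support_iff, hcoeff e h] at he
        simp [he]
    -- The constant monomial may be new in f - 1; this costs one monomial and turns d + 5 into d +
    -- 3.
    have hcard := (Finset.card_le_card hsub).trans (Finset.card_insert_le _ _)
    rw [hsum] at key
    omega
  · simp only [hQ, le_refl, if_true, Nat.sub_self, hz]
    linarith
  · intro m a h
    simp [hQ, h]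
  · intro m a h
    simp only [hQ]
    split_ifs with ha
    · apply coeff_eq_zero_of_totalDegree_lt
      change _ < (expPair a (m - a)).degree
      rw [degree_expPair]
      omega
    · rfl
  · simp only [hP, le_refl, if_true, Nat.sub_self, hz, hcoeff0]
    linarith
  · intro m
    simp only [hP, hQ, Nat.zero_le, if_true, Nat.sub_zero]
    rw [hq, coeff_linear_mul, coeff_X_zero_mul_expPair_zero, coeff_X_one_mul_expPair_succ, zero_add]
  · intro m a
    simp only [hP, hQ]
    rcases lt_trichotomy a m with h | h | h
    · rw [if_pos (by omega), if_pos (by omega), if_pos (by omega), if_pos (by omega), hq,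
        coeff_linear_mul, coeff_X_zero_mul_expPair_succ,
        show m + 1 - (a + 1) = m - (a + 1) + 1 by omega, coeff_X_one_mul_expPair_succ,
        show m - (a + 1) + 1 = m - a by omega]
    · subst h
      rw [if_pos le_rfl, if_pos le_rfl, if_neg (by omega), if_pos le_rfl, Nat.sub_self, Nat.sub_self,
        hq, coeff_linear_mul, coeff_X_zero_mul_expPair_succ, coeff_X_one_mul_expPair_zero]
    · rw [if_neg (by omega), if_neg (by omega), if_neg (by omega), if_neg (by omega)]
      simp
  · intro m a
    simp only [hP]
    split_ifs with h
    · rw [hcoeff]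
      · exact hpos _
      · rw [Ne, expPair_eq_zero]; omega
    · exact le_rfl
  · have hf : f.support.Nonempty := by
      rw [support_nonempty]
      rintro rfl
      simp at hd
      omega
    obtain ⟨e, he, hed⟩ := Finset.exists_mem_eq_sup f.support hf (fun s => s.sum fun _ e => e)
    have hsum : d = e 0 + e 1 := by
      rw [← degree_expPair, expPair_eta, hd]
      exact hed
    refine ⟨e 0, ?_⟩
    simp only [hP]
    rw [if_pos (by omega), show d - e 0 = e 1 by omega, expPair_eta, hcoeff]
    · exact mem_support_iff.1 he
    · rintro rfl
      simp at hsum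
      omega

end LinearFactor

/-! ### Dehomogenization and the homogeneous estimate -/

section Homogeneous

open MvPolynomial

/-- Forgetting the last exponent. -/
noncomputable def dropLast (e : Fin 3 →₀ ℕ) : Fin 2 →₀ ℕ := expPair (e 0) (e 1)

lemma aeval_dehomogenize_monomial (e : Fin 3 →₀ ℕ) (c : ℝ) :
    aeval ![X 0, X 1, (-1 : MvPolynomial (Fin 2) ℝ)] (monomial e c) =
      monomial (dropLast e) (c * (-1) ^ e 2) := by
  rw [aeval_monomial, Finsupp.prod_fintype _ _ (by simp), Fin.prod_univ_three, monomial_eq,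
    Finsupp.prod_fintype _ _ (by simp), Fin.prod_univ_two]
  simp [dropLast, expPair, algebraMap_eq]
  ring

lemma support_aeval_dehomogenize_subset (p : MvPolynomial (Fin 3) ℝ) :
    (aeval ![X 0, X 1, (-1 : MvPolynomial (Fin 2) ℝ)] p).support ⊆ p.support.image dropLast := by
  classical
  conv_lhs => rw [p.as_sum, map_sum]
  refine support_sum.trans ?_
  intro e he
  rw [Finset.mem_biUnion] at he
  obtain ⟨u, hu, he⟩ := he
  rw [aeval_dehomogenize_monomial] at he
  have := support_monomial_subset he
  rw [Finset.mem_singleton] at this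
  exact Finset.mem_image.2 ⟨u, hu, this.symm⟩

lemma coeff_zero_tildePoly {d : ℕ} {p : MvPolynomial (Fin 3) ℝ} (hp : IsHomogForm d p) :
    coeff 0 (tildePoly p) = 0 := by
  have h := hp.eval_last (-1)
  have h2 : constantCoeff (tildePoly p) = eval ![0, 0, -1] p + 1 := by
    rw [tildePoly, map_add, map_one]
    have hc : (aeval (0 : Fin 2 → ℝ)).comp (aeval ![X 0, X 1, (-1 : MvPolynomial (Fin 2) ℝ)]) =
        (aeval ![0, 0, -1] : MvPolynomial (Fin 3) ℝ →ₐ[ℝ] ℝ) := by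
      ext i
      fin_cases i <;> simp
    have := DFunLike.congr_fun hc p
    rw [AlgHom.comp_apply, aeval_zero] at this
    exact congrArg (· + 1) this
  rw [← constantCoeff_eq, h2, h]
  simp

lemma linear_dvd_tildePoly_sub_one {d : ℕ} {p : MvPolynomial (Fin 3) ℝ} (hp : IsHomogForm d p) :
    X 0 + X 1 - 1 ∣ tildePoly p - 1 := by
  obtain ⟨q, hq⟩ := hp.dvd
  refine ⟨aeval ![X 0, X 1, -1] q, ?_⟩
  rw [tildePoly, hq, add_sub_cancel_right, map_mul, map_add, map_add, aeval_X, aeval_X, aeval_X,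
    sub_eq_add_neg]
  rfl

/-- Setting x₃ = -1 cannot increase the number of monomials, and the result is p̃ - 1, whose
constant term -1 is a monomial that p̃ lacks. -/
lemma card_support_tildePoly_add_one_le {d : ℕ} {p : MvPolynomial (Fin 3) ℝ}
    (hp : IsHomogForm d p) : (tildePoly p).support.card + 1 ≤ monomialRank p := by
  classical
  have h0 := coeff_zero_tildePoly hp
  have hsub : insert 0 (tildePoly p).support ⊆ p.support.image dropLast := by
    refine Finset.Subset.trans ?_ (support_aeval_dehomogenize_subset p)
    have he : aeval ![X 0, X 1, (-1 : MvPolynomial (Fin 2) ℝ)] p = tildePoly p - 1 := by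
      simp [tildePoly]
    rw [he]
    intro e he
    rw [mem_support_iff, coeff_sub, coeff_one]
    rcases Finset.mem_insert.1 he with rfl | he
    · simp [h0]
    · have : (0 : Fin 2 →₀ ℕ) ≠ e := by
        rintro rfl
        exact mem_support_iff.1 he h0
      rw [if_neg this, sub_zero]
      exact mem_support_iff.1 he
  have h := (Finset.card_le_card hsub).trans Finset.card_image_le
  rwa [Finset.card_insert_of_notMem (by simp [h0])] at h

lemma IsHomogForm.add_three_le {d : ℕ} {p : MvPolynomial (Fin 3) ℝ} (hp : IsHomogForm d p) :
    d + 3 ≤ 2 * (tildePoly p).support.card := by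
  have h := totalDegree_add_three_le hp.coeff_nonneg
    (by rw [coeff_zero_tildePoly hp]; exact one_pos) (linear_dvd_tildePoly_sub_one hp)
  rwa [hp.totalDegree_tilde] at h

/-- The homogeneous form of the degree estimate. -/
theorem IsHomogForm.add_five_le {d : ℕ} {p : MvPolynomial (Fin 3) ℝ} (hp : IsHomogForm d p) :
    d + 5 ≤ 2 * monomialRank p := by
  have h1 := hp.add_three_le
  have h2 := card_support_tildePoly_add_one_le hp
  omega

end Homogeneous

/-! ### Lucas polynomials and sharpness -/

section Sharp

open MvPolynomial

/-- The homogeneous Lucas polynomials, i.e. the power sums `α ^ n + β ^ n` of the roots of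
`t ^ 2 - x t + y z`. -/
noncomputable def lucasPoly : ℕ → MvPolynomial (Fin 3) ℝ
  | 0 => 2
  | 1 => X 0
  | n + 2 => X 0 * lucasPoly (n + 1) - X 1 * X 2 * lucasPoly n

/-- Modulo x + y + z the roots of t² - x t + y z are -y and -z, so the power sums become explicit.
For odd n, adding yⁿ + zⁿ therefore gives a multiple of x + y + z. -/
lemma dvd_lucasPoly_sub (n : ℕ) :
    (X 0 + X 1 + X 2 : MvPolynomial (Fin 3) ℝ) ∣ lucasPoly n - ((-X 1) ^ n + (-X 2) ^ n) := by
  induction n using Nat.twoStepInduction with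
  | zero => simp [lucasPoly]; norm_num
  | one => exact ⟨1, by simp only [lucasPoly]; ring⟩
  | more n ih0 ih1 =>
    obtain ⟨u, hu⟩ := ih0
    obtain ⟨v, hv⟩ := ih1
    refine ⟨X 0 * v - X 1 * X 2 * u + ((-X 1) ^ (n + 1) + (-X 2) ^ (n + 1)), ?_⟩
    rw [sub_eq_iff_eq_add] at hu hv
    rw [lucasPoly, hu, hv]
    ring

lemma lucasPoly_isHomogeneous (n : ℕ) : (lucasPoly n).IsHomogeneous n := by
  induction n using Nat.twoStepInduction with
  | zero => exact isHomogeneous_C (Fin 3) (2 : ℝ)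
  | one => exact isHomogeneous_X _ _
  | more n ih0 ih1 =>
    rw [lucasPoly]
    refine IsHomogeneous.sub ?_ ?_
    · have := (isHomogeneous_X ℝ (0 : Fin 3)).mul ih1
      rwa [show 1 + (n + 1) = n + 2 by ring] at this
    · have := ((isHomogeneous_X ℝ (1 : Fin 3)).mul (isHomogeneous_X ℝ (2 : Fin 3))).mul ih0
      rwa [show 1 + 1 + n = n + 2 by ring] at this

/-- The exponent of the monomial `x ^ (n - 2 j) * (y z) ^ j`. -/
noncomputable def lucasExp (n j : ℕ) : Fin 3 →₀ ℕ :=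
  Finsupp.single 0 (n - 2 * j) + Finsupp.single 1 j + Finsupp.single 2 j

lemma support_lucasPoly_subset (n : ℕ) :
    ∀ e ∈ (lucasPoly n).support, ∃ j, 2 * j ≤ n ∧ e = lucasExp n j := by
  classical
  induction n using Nat.twoStepInduction with
  | zero =>
    intro e he
    have : e = 0 := by
      have := support_monomial_subset (s := (0 : Fin 3 →₀ ℕ)) (a := (2 : ℝ)) he
      simpa using this
    exact ⟨0, le_rfl, by simp [this, lucasExp]⟩
  | one =>
    intro e he
    have := support_monomial_subset (s := Finsupp.single (0 : Fin 3) 1) (a := (1 : ℝ)) he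
    exact ⟨0, by omega, by simpa [lucasExp] using this⟩
  | more n ih0 ih1 =>
    intro e he
    rw [lucasPoly] at he
    rcases Finset.mem_union.1 (support_sub _ _ _ he) with he | he
    · rw [support_X_mul, Finset.mem_map] at he
      obtain ⟨u, hu, rfl⟩ := he
      obtain ⟨j, hj, rfl⟩ := ih1 u hu
      refine ⟨j, by omega, ?_⟩
      ext i
      fin_cases i <;> simp [lucasExp]
      omega
    · rw [mul_assoc, support_X_mul, Finset.mem_map] at he
      obtain ⟨u, hu, rfl⟩ := he
      rw [support_X_mul, Finset.mem_map] at hu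
      obtain ⟨w, hw, rfl⟩ := hu
      obtain ⟨j, hj, rfl⟩ := ih0 w hw
      refine ⟨j + 1, by omega, ?_⟩
      ext i
      fin_cases i <;> simp [lucasExp] <;> omega

/-- The sharp polynomials, of odd degree `d`. -/
noncomputable def sharpPoly (d : ℕ) : MvPolynomial (Fin 3) ℝ := lucasPoly d + X 1 ^ d + X 2 ^ d

lemma card_support_sharpPoly_le (d : ℕ) : (sharpPoly d).support.card ≤ d / 2 + 3 := by
  classical
  have hsub : (sharpPoly d).support ⊆ (Finset.range (d / 2 + 1)).image (lucasExp d) ∪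
      {Finsupp.single 1 d} ∪ {Finsupp.single 2 d} := by
    refine support_add.trans (Finset.union_subset_union (support_add.trans
      (Finset.union_subset_union ?_ ?_)) ?_)
    · intro e he
      obtain ⟨j, hj, rfl⟩ := support_lucasPoly_subset d e he
      exact Finset.mem_image_of_mem _ (Finset.mem_range.2 (by omega))
    · rw [X_pow_eq_monomial]; exact support_monomial_subset
    · rw [X_pow_eq_monomial]; exact support_monomial_subset
  refine (Finset.card_le_card hsub).trans ((Finset.card_union_le _ _).trans ?_)
  have h1 := Finset.card_union_le ((Finset.range (d / 2 + 1)).image (lucasExp d))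
    {Finsupp.single 1 d}
  have h2 : ((Finset.range (d / 2 + 1)).image (lucasExp d)).card ≤ d / 2 + 1 :=
    Finset.card_image_le.trans (by simp)
  simp only [Finset.card_singleton] at h1 ⊢
  omega

/-- The dehomogenization of the Lucas polynomials. -/
noncomputable def lucasTilde : ℕ → MvPolynomial (Fin 2) ℝ
  | 0 => 2
  | 1 => X 0
  | n + 2 => X 0 * lucasTilde (n + 1) + X 1 * lucasTilde n

lemma aeval_lucasPoly (n : ℕ) :
    aeval ![X 0, X 1, (-1 : MvPolynomial (Fin 2) ℝ)] (lucasPoly n) = lucasTilde n := by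
  induction n using Nat.twoStepInduction with
  | zero => simp only [lucasPoly, lucasTilde]; exact map_ofNat _ 2
  | one => simp only [lucasPoly, lucasTilde, aeval_X]; rfl
  | more n ih0 ih1 =>
    simp only [lucasPoly, lucasTilde, map_sub, map_mul, ih0, ih1, aeval_X]
    simp

lemma tildePoly_sharpPoly {d : ℕ} (hd : Odd d) :
    tildePoly (sharpPoly d) = lucasTilde d + X 1 ^ d := by
  simp only [tildePoly, sharpPoly, map_add, aeval_lucasPoly, map_pow, aeval_X]
  simp [hd.neg_one_pow]

lemma coeff_lucasTilde_nonneg (n : ℕ) (e : Fin 2 →₀ ℕ) : 0 ≤ coeff e (lucasTilde n) := by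
  induction n using Nat.twoStepInduction generalizing e with
  | zero =>
    change 0 ≤ coeff e (C 2)
    rw [coeff_C]; split_ifs <;> norm_num
  | one => simp only [lucasTilde, coeff_X]; split_ifs <;> norm_num
  | more n ih0 ih1 =>
    rw [lucasTilde, coeff_add, coeff_X_mul', coeff_X_mul']
    refine add_nonneg ?_ ?_ <;> split_ifs <;> first | exact le_rfl | exact ih1 _ | exact ih0 _

lemma totalDegree_lucasTilde_le (n : ℕ) : (lucasTilde n).totalDegree ≤ n := by
  induction n using Nat.twoStepInduction with
  | zero => exact (totalDegree_C (2 : ℝ)).le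
  | one => exact (totalDegree_X (R := ℝ) (0 : Fin 2)).le
  | more n ih0 ih1 =>
    rw [lucasTilde]
    refine (totalDegree_add _ _).trans (max_le ?_ ?_)
    · refine (totalDegree_mul _ _).trans ?_
      rw [totalDegree_X]; omega
    · refine (totalDegree_mul _ _).trans ?_
      rw [totalDegree_X]; omega

lemma coeff_lucasTilde_X_pow (n : ℕ) : coeff (expPair (n + 1) 0) (lucasTilde (n + 1)) = 1 := by
  induction n with
  | zero => simp [lucasTilde, expPair]
  | succ n ih =>
    rw [lucasTilde, coeff_add, coeff_X_zero_mul_expPair_succ, coeff_X_one_mul_expPair_zero, ih,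
      add_zero]

lemma eval_lucasPoly (n : ℕ) (t : ℝ) : eval ![0, 0, t] (lucasPoly (n + 1)) = 0 := by
  cases n <;> simp [lucasPoly]

/-- The sharp polynomials satisfy the hypotheses of the homogeneous degree estimate. -/
theorem isHomogForm_sharpPoly {d : ℕ} (hd : Odd d) : IsHomogForm d (sharpPoly d) where
  homogeneous :=
    ((lucasPoly_isHomogeneous d).add (isHomogeneous_X_pow 1 d)).add (isHomogeneous_X_pow 2 d)
  eval_last t := by
    obtain ⟨n, rfl⟩ : ∃ n, d = n + 1 := ⟨d - 1, by have := hd.pos; omega⟩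
    simp [sharpPoly, eval_lucasPoly, hd.neg_pow]
  coeff_nonneg e := by
    rw [tildePoly_sharpPoly hd, coeff_add, X_pow_eq_monomial, coeff_monomial]
    refine add_nonneg (coeff_lucasTilde_nonneg d e) ?_
    split_ifs <;> norm_num
  totalDegree_tilde := by
    rw [tildePoly_sharpPoly hd]
    refine le_antisymm ((totalDegree_add _ _).trans (max_le (totalDegree_lucasTilde_le d) ?_)) ?_
    · rw [totalDegree_X_pow]
    · obtain ⟨n, rfl⟩ : ∃ n, d = n + 1 := ⟨d - 1, by have := hd.pos; omega⟩
      have h : expPair (n + 1) 0 ∈ (lucasTilde (n + 1) + X 1 ^ (n + 1)).support := by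
        rw [mem_support_iff, coeff_add, coeff_lucasTilde_X_pow, X_pow_eq_monomial, coeff_monomial]
        split_ifs <;> norm_num
      have := le_totalDegree h
      change (expPair (n + 1) 0).degree ≤ _ at this
      rwa [degree_expPair] at this
  dvd := by
    have h := dvd_lucasPoly_sub d
    rw [hd.neg_pow, hd.neg_pow] at h
    obtain ⟨q, hq⟩ := h
    exact ⟨q, by rw [← hq, sharpPoly]; ring⟩

/-- The support bound gives ≤ and the degree estimate itself gives ≥, so no coefficient of the Lucas
polynomial has to be shown nonzero. -/
theorem two_mul_monomialRank_sharpPoly {d : ℕ} (hd : Odd d) :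
    2 * monomialRank (sharpPoly d) = d + 5 := by
  have h1 := (isHomogForm_sharpPoly hd).add_five_le
  have h2 : monomialRank (sharpPoly d) ≤ d / 2 + 3 := card_support_sharpPoly_le d
  obtain ⟨r, rfl⟩ := hd
  omega

theorem two_mul_card_support_tildePoly_sharpPoly {d : ℕ} (hd : Odd d) :
    2 * (tildePoly (sharpPoly d)).support.card = d + 3 := by
  have h1 := two_mul_monomialRank_sharpPoly hd
  have h2 := card_support_tildePoly_add_one_le (isHomogForm_sharpPoly hd)
  have h3 := (isHomogForm_sharpPoly hd).add_three_le
  omega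

end Sharp

/-! ### Properness and boundary behaviour -/

section ProperMaps

open Filter Topology

variable {E F : Type*} [NormedAddCommGroup E] [NormedAddCommGroup F]

/-- A proper map between unit balls that extends continuously maps the sphere to the sphere. -/
lemma norm_eq_one_of_isProperMap [NormedSpace ℝ E]
    {φ : Metric.ball (0 : E) 1 → Metric.ball (0 : F) 1} {Φ : E → F}
    (hΦ : Continuous Φ) (hφ : ∀ z, (φ z : F) = Φ z) (hprop : IsProperMap φ) {z : E}
    (hz : ‖z‖ = 1) : ‖Φ z‖ = 1 := by
  have hcl : z ∈ closure (Metric.ball (0 : E) 1) := by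
    rw [closure_ball _ one_ne_zero]; simp [hz]
  refine le_antisymm ?_ (not_lt.1 fun hlt => ?_)
  · have hsub : Metric.ball (0 : E) 1 ⊆ {w | ‖Φ w‖ ≤ 1} := by
      intro w hw
      have h := (φ ⟨w, hw⟩).2
      rw [mem_ball_zero_iff, hφ] at h
      exact h.le
    exact closure_minimal hsub (isClosed_le hΦ.norm continuous_const) hcl
  -- `l` is the filter of points of the ball tending to z. If Φ z were interior, properness would
  -- give `l` a cluster point inside the ball, but that point must be z.
  · set l : Filter (Metric.ball (0 : E) 1) := comap Subtype.val (𝓝 z) with hl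
    have hne : l.NeBot := by
      rw [mem_closure_iff_comap_neBot] at hcl
      exact hcl
    have hmap : map Subtype.val l ≤ 𝓝 z := map_comap_le
    have htend : Tendsto φ l (𝓝 ⟨Φ z, mem_ball_zero_iff.2 hlt⟩) := by
      rw [tendsto_subtype_rng]
      simp only [hφ]
      exact (hΦ.tendsto z).comp hmap
    obtain ⟨x, -, hx⟩ := hprop.clusterPt_of_mapClusterPt htend.mapClusterPt
    have hxz : (x : E) = z := by
      have h : ClusterPt (x : E) (map Subtype.val l) :=
        hx.map continuous_subtype_val.continuousAt tendsto_map
      have : (𝓝 (x : E) ⊓ 𝓝 z).NeBot := h.mono hmap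
      exact eq_of_nhds_neBot this
    have := mem_ball_zero_iff.1 x.2
    rw [hxz, hz] at this
    exact lt_irrefl _ this

/-- A continuous map that maps the unit ball to the unit ball and the sphere to the sphere restricts
to a proper map between the balls. -/
lemma isProperMap_of_norm_eq_one [ProperSpace E]
    {φ : Metric.ball (0 : E) 1 → Metric.ball (0 : F) 1} {Φ : E → F} (hΦ : Continuous Φ)
    (hφ : ∀ z, (φ z : F) = Φ z) (hsphere : ∀ z, ‖z‖ = 1 → ‖Φ z‖ = 1) : IsProperMap φ := by
  rw [isProperMap_iff_ultrafilter]
  constructor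
  · rw [continuous_induced_rng]
    have : (Subtype.val ∘ φ) = Φ ∘ Subtype.val := funext hφ
    rw [this]
    exact hΦ.comp continuous_subtype_val
  · intro u y hy
    have hle : ((u.map Subtype.val : Ultrafilter E) : Filter E) ≤
        𝓟 (Metric.closedBall (0 : E) 1) := by
      rw [le_principal_iff]
      exact mem_map.2 (univ_mem' fun w => Metric.ball_subset_closedBall w.2)
    obtain ⟨z, hz, hzu⟩ := (isCompact_closedBall (0 : E) 1).ultrafilter_le_nhds _ hle
    have h1 : Tendsto (fun w => (φ w : F)) u (𝓝 y) := (continuous_subtype_val.tendsto y).comp hy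
    have h2 : Tendsto (fun w => (φ w : F)) u (𝓝 (Φ z)) := by
      simp only [hφ]
      exact (hΦ.tendsto z).comp hzu
    have hyz : (y : F) = Φ z := tendsto_nhds_unique h1 h2
    -- A limit on the sphere would be sent to the sphere, while y is in the open ball.
    have hlt : ‖z‖ < 1 := by
      refine lt_of_le_of_ne (mem_closedBall_zero_iff.1 hz) fun h => ?_
      have := mem_ball_zero_iff.1 y.2
      rw [hyz, hsphere z h] at this
      exact lt_irrefl _ this
    refine ⟨⟨z, mem_ball_zero_iff.2 hlt⟩, Subtype.ext ?_, ?_⟩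
    · rw [hφ, hyz]
    · rw [nhds_induced, ← map_le_iff_le_comap]
      exact hzu

end ProperMaps

/-! ### Monomial maps and their squared norms -/

section MonomialMaps

open MvPolynomial

variable {n k : ℕ}

/-- The map `ℂⁿ → ℂᵏ` with components the monomials `C i * z ^ a i`. -/
noncomputable def monomialMap (a : Fin k → Fin n →₀ ℕ) (C : Fin k → ℂ)
    (z : EuclideanSpace ℂ (Fin n)) : EuclideanSpace ℂ (Fin k) :=
  WithLp.toLp 2 fun i => eval (fun j => z j) (monomial (a i) (C i))

/-- The polynomial whose value at `(|z₁|², …, |zₙ|²)` is the squared norm of the monomial map. -/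
noncomputable def normSqPoly (a : Fin k → Fin n →₀ ℕ) (C : Fin k → ℂ) : MvPolynomial (Fin n) ℝ :=
  ∑ i, monomial (a i) (‖C i‖ ^ 2)

variable {a : Fin k → Fin n →₀ ℕ} {C : Fin k → ℂ}

lemma continuous_monomialMap : Continuous (monomialMap a C) := by
  refine (PiLp.continuous_toLp 2 _).comp (continuous_pi fun i => ?_)
  exact (continuous_eval (monomial (a i) (C i))).comp (PiLp.continuous_ofLp 2 _)

lemma norm_sq_monomialMap (z : EuclideanSpace ℂ (Fin n)) :
    ‖monomialMap a C z‖ ^ 2 = eval (fun j => ‖z j‖ ^ 2) (normSqPoly a C) := by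
  rw [EuclideanSpace.norm_sq_eq, normSqPoly, map_sum]
  refine Finset.sum_congr rfl fun i _ => ?_
  simp only [monomialMap, eval_monomial, norm_mul, mul_pow]
  congr 1
  rw [Finsupp.prod, Finsupp.prod, norm_prod, ← Finset.prod_pow]
  refine Finset.prod_congr rfl fun j _ => ?_
  rw [norm_pow, ← pow_mul, ← pow_mul, mul_comm]

lemma coeff_normSqPoly_nonneg (e : Fin n →₀ ℕ) : 0 ≤ coeff e (normSqPoly a C) := by
  classical
  rw [normSqPoly, coeff_sum]
  refine Finset.sum_nonneg fun i _ => ?_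
  rw [coeff_monomial]
  split_ifs <;> positivity

lemma coeff_normSqPoly_ne_zero {i : Fin k} (h : C i ≠ 0) : coeff (a i) (normSqPoly a C) ≠ 0 := by
  classical
  rw [normSqPoly, coeff_sum]
  refine (Finset.sum_pos' (fun j _ => ?_) ⟨i, Finset.mem_univ i, ?_⟩).ne'
  · rw [coeff_monomial]
    split_ifs <;> positivity
  · rw [coeff_monomial, if_pos rfl]
    positivity

lemma card_support_normSqPoly_le : (normSqPoly a C).support.card ≤ k := by
  classical
  have hsub : (normSqPoly a C).support ⊆ Finset.univ.image a := by
    refine support_sum.trans fun e he => ?_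
    obtain ⟨i, hi, he⟩ := Finset.mem_biUnion.1 he
    have := Finset.mem_singleton.1 (support_monomial_subset he)
    exact Finset.mem_image.2 ⟨i, hi, this.symm⟩
  simpa using (Finset.card_le_card hsub).trans Finset.card_image_le

lemma totalDegree_monomial_le_normSqPoly (i : Fin k) :
    (monomial (a i) (C i)).totalDegree ≤ (normSqPoly a C).totalDegree := by
  by_cases h : C i = 0
  · simp [h]
  · rw [totalDegree_monomial _ h]
    exact le_totalDegree (mem_support_iff.2 (coeff_normSqPoly_ne_zero h))

/-- The point of the unit sphere of `ℂ²` with squared moduli `t` and `1 - t`. -/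
lemma exists_sphere_point {t : ℝ} (ht : t ∈ Set.Icc (0 : ℝ) 1) :
    ∃ z : EuclideanSpace ℂ (Fin 2), ‖z‖ = 1 ∧ (fun j => ‖z j‖ ^ 2) = ![t, 1 - t] := by
  have h1 : 0 ≤ 1 - t := by linarith [ht.2]
  have hz : (fun j => ‖(!₂[((√t : ℝ) : ℂ), ((√(1 - t) : ℝ) : ℂ)] : EuclideanSpace ℂ (Fin 2)) j‖ ^ 2)
      = ![t, 1 - t] := by
    ext j
    fin_cases j
    · simp [Real.sq_sqrt ht.1]
    · simp [Real.sq_sqrt h1]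
  refine ⟨_, ?_, hz⟩
  rw [← sq_eq_sq₀ (norm_nonneg _) zero_le_one, EuclideanSpace.norm_sq_eq]
  have h := fun j => congrFun hz j
  rw [Fin.sum_univ_two, h 0, h 1]
  simp

/-- A polynomial that equals `1` on a segment of the line `x + y = 1` is `1` modulo `x + y - 1`. -/
lemma linear_dvd_sub_one {f : MvPolynomial (Fin 2) ℝ}
    (hf : ∀ t ∈ Set.Icc (0 : ℝ) 1, eval ![t, 1 - t] f = 1) : X 0 + X 1 - 1 ∣ f - 1 := by
  set g : Polynomial ℝ := aeval ![Polynomial.X, 1 - Polynomial.X] f with hg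
  have hg1 : g = 1 := by
    refine Polynomial.eq_of_infinite_eval_eq g 1 ((Set.Icc_infinite zero_lt_one).mono ?_)
    intro t ht
    have hc : (Polynomial.aeval t).comp (aeval ![Polynomial.X, 1 - Polynomial.X]) =
        (aeval ![t, 1 - t] : MvPolynomial (Fin 2) ℝ →ₐ[ℝ] ℝ) := by
      ext i
      fin_cases i <;> simp
    have h := DFunLike.congr_fun hc f
    change Polynomial.eval t g = Polynomial.eval t 1
    rw [Polynomial.eval_one, ← hf t ht]
    exact h
  set I : Ideal (MvPolynomial (Fin 2) ℝ) := Ideal.span {X 0 + X 1 - 1} with hI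
  -- In the quotient by x + y - 1 one has y = 1 - x, so the class of f is g evaluated at the class
  -- of x; as g = 1, that class is 1.
  have hc : (Polynomial.aeval (Ideal.Quotient.mkₐ ℝ I (X 0))).comp
      (aeval ![Polynomial.X, 1 - Polynomial.X]) = Ideal.Quotient.mkₐ ℝ I := by
    ext i
    fin_cases i
    · simp
    · have : (X 0 + X 1 - 1 : MvPolynomial (Fin 2) ℝ) ∈ I := Ideal.mem_span_singleton_self _
      have h := Ideal.Quotient.eq_zero_iff_mem.2 this
      simp only [map_sub, map_add, map_one] at h
      simp
      linear_combination -h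
  have h := DFunLike.congr_fun hc f
  rw [AlgHom.comp_apply, ← hg, hg1, map_one, Ideal.Quotient.mkₐ_eq_mk, eq_comm,
    ← map_one (Ideal.Quotient.mk I), Ideal.Quotient.eq, hI, Ideal.mem_span_singleton] at h
  exact h

/-- The degree estimate for proper monomial maps from `B₂`. -/
theorem degree_add_three_le_of_isProperMap {k d : ℕ} {φ : UnitBall 2 → UnitBall k}
    (hprop : IsProperMap φ) (hφ : IsMonomialMapOfDegree φ d) : d + 3 ≤ 2 * k := by
  obtain ⟨f, hmon, heval, rfl⟩ := hφ
  choose a C hf using hmon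
  have hval : ∀ z : UnitBall 2, (φ z : EuclideanSpace ℂ (Fin k)) = monomialMap a C z := by
    intro z
    ext i
    rw [heval, hf, monomialMap]
  have hsphere : ∀ t ∈ Set.Icc (0 : ℝ) 1, eval ![t, 1 - t] (normSqPoly a C) = 1 := by
    intro t ht
    obtain ⟨z, hz, hzt⟩ := exists_sphere_point ht
    rw [← hzt, ← norm_sq_monomialMap,
      norm_eq_one_of_isProperMap continuous_monomialMap hval hprop hz, one_pow]
  -- The constant coefficient is ‖φ(0)‖², and φ(0) lies in the open ball.
  have h0 : coeff 0 (normSqPoly a C) < 1 := by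
    have h := (φ ⟨0, by simp⟩).2
    rw [mem_ball_zero_iff, hval, ← sq_lt_one_iff₀ (norm_nonneg _), norm_sq_monomialMap] at h
    rw [← constantCoeff_eq, ← eval_zero]
    have hz : (fun j => ‖(0 : EuclideanSpace ℂ (Fin 2)) j‖ ^ 2) = 0 := by
      ext j
      simp
    rwa [hz] at h
  have h := totalDegree_add_three_le coeff_normSqPoly_nonneg h0 (linear_dvd_sub_one hsphere)
  have hk := card_support_normSqPoly_le (a := a) (C := C)
  have hd : Finset.univ.sup (fun i => (f i).totalDegree) ≤ (normSqPoly a C).totalDegree :=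
    Finset.sup_le fun i _ => by rw [hf]; exact totalDegree_monomial_le_normSqPoly i
  omega

/-- A polynomial with non-negative coefficients and no constant term that equals `1` on the line
`x + y = 1` is bounded by `x + y` below that line. -/
lemma eval_le_of_linear_dvd {f : MvPolynomial (Fin 2) ℝ} (hpos : ∀ e, 0 ≤ coeff e f)
    (h0 : coeff 0 f = 0) (hdvd : X 0 + X 1 - 1 ∣ f - 1) {v : Fin 2 → ℝ} (hv : ∀ j, 0 ≤ v j)
    (hle : v 0 + v 1 ≤ 1) : eval v f ≤ v 0 + v 1 := by
  set t := v 0 + v 1 with ht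
  have ht0 : 0 ≤ t := add_nonneg (hv 0) (hv 1)
  rcases ht0.eq_or_lt with h | h
  · have hv0 : v = 0 := by
      ext j
      have := hv 0
      have := hv 1
      fin_cases j
      · change v 0 = 0; linarith
      · change v 1 = 0; linarith
    rw [hv0, eval_zero, constantCoeff_eq, h0, ← h]
  -- Scale v to the line x + y = 1, where f = 1. Every monomial has degree at least 1, so scaling
  -- back multiplies it by at most t.
  · set w : Fin 2 → ℝ := fun j => v j / t with hw
    have hw1 : eval w f = 1 := by
      obtain ⟨q, hq⟩ := hdvd
      have := congrArg (eval w) hq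
      have hs : w 0 + w 1 = 1 := by rw [hw]; field_simp; exact ht.symm
      simp only [map_sub, map_one, map_mul, map_add, eval_X, hs] at this
      linarith
    calc eval v f ≤ ∑ e ∈ f.support, t * (coeff e f * ∏ j, w j ^ e j) := by
          rw [eval_eq']
          refine Finset.sum_le_sum fun e he => ?_
          have hvw : ∀ j, v j = t * w j := fun j => by rw [hw]; field_simp
          have hw0 : ∀ j, 0 ≤ w j := fun j => div_nonneg (hv j) ht0
          have hedeg : e 0 + e 1 ≠ 0 := by
            intro hz
            have : e = 0 := by
              ext j
              fin_cases j
              · change e 0 = 0; omega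
              · change e 1 = 0; omega
            rw [this, mem_support_iff] at he
            exact he h0
          have hpow : t ^ (e 0 + e 1) ≤ t := pow_le_of_le_one ht0 hle hedeg
          have heq : ∏ j, v j ^ e j = t ^ (e 0 + e 1) * ∏ j, w j ^ e j := by
            rw [Fin.prod_univ_two, Fin.prod_univ_two, hvw 0, hvw 1, mul_pow, mul_pow, pow_add]
            ring
          rw [heq]
          have hnn : 0 ≤ coeff e f * ∏ j, w j ^ e j :=
            mul_nonneg (hpos e) (Finset.prod_nonneg fun j _ => pow_nonneg (hw0 j) _)
          nlinarith [mul_le_mul_of_nonneg_right hpow hnn]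
      _ = t := by rw [← Finset.mul_sum, ← eval_eq', hw1, mul_one]

/-- A polynomial with non-negative coefficients is the squared norm polynomial of the monomial map
given by the square roots of its coefficients. -/
lemma exists_normSqPoly_eq {f : MvPolynomial (Fin n) ℝ} (hpos : ∀ e, 0 ≤ coeff e f)
    (hk : f.support.card = k) :
    ∃ (a : Fin k → Fin n →₀ ℕ) (C : Fin k → ℂ), normSqPoly a C = f ∧
      Finset.univ.sup (fun i => (monomial (a i) (C i)).totalDegree) = f.totalDegree := by
  let e := f.support.equivFinOfCardEq hk
  have hne : ∀ i, coeff (e.symm i : Fin n →₀ ℕ) f ≠ 0 := fun i => mem_support_iff.1 (e.symm i).2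
  refine ⟨fun i => e.symm i, fun i => ((√(coeff (e.symm i : Fin n →₀ ℕ) f) : ℝ) : ℂ), ?_, ?_⟩
  · have h : ∀ i, ‖((√(coeff (e.symm i : Fin n →₀ ℕ) f) : ℝ) : ℂ)‖ ^ 2 =
        coeff (e.symm i : Fin n →₀ ℕ) f := by
      intro i
      rw [Complex.norm_real, Real.norm_eq_abs, sq_abs, Real.sq_sqrt (hpos _)]
    simp only [normSqPoly, h]
    rw [e.symm.sum_comp (fun s : f.support => monomial (s : Fin n →₀ ℕ) (coeff (s : Fin n →₀ ℕ) f)),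
      Finset.sum_coe_sort f.support (fun s => monomial s (coeff s f)), ← f.as_sum]
  · have h : ∀ i, (monomial (e.symm i : Fin n →₀ ℕ)
        ((√(coeff (e.symm i : Fin n →₀ ℕ) f) : ℝ) : ℂ)).totalDegree =
        (e.symm i : Fin n →₀ ℕ).sum fun _ x => x := by
      intro i
      refine totalDegree_monomial _ ?_
      rw [Ne, Complex.ofReal_eq_zero, Real.sqrt_eq_zero (hpos _)]
      exact hne i
    simp only [h]
    refine le_antisymm (Finset.sup_le fun i _ => le_totalDegree (e.symm i).2)
      (Finset.sup_le fun s hs => ?_)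
    have := Finset.le_sup (f := fun i => (e.symm i : Fin n →₀ ℕ).sum fun _ x => x)
      (Finset.mem_univ (e ⟨s, hs⟩))
    simpa using this

/-- A polynomial in two variables with non-negative coefficients and no constant term that equals `1`
on the line `x + y = 1` gives rise to a proper monomial map. -/
theorem exists_isProperMap_of_linear_dvd {f : MvPolynomial (Fin 2) ℝ} (hpos : ∀ e, 0 ≤ coeff e f)
    (h0 : coeff 0 f = 0) (hdvd : X 0 + X 1 - 1 ∣ f - 1) :
    ∃ φ : UnitBall 2 → UnitBall f.support.card,
      IsProperMap φ ∧ IsMonomialMapOfDegree φ f.totalDegree := by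
  obtain ⟨a, C, hf, hdeg⟩ := exists_normSqPoly_eq hpos rfl
  have hnorm : ∀ z : EuclideanSpace ℂ (Fin 2), ‖z‖ ^ 2 = ‖z 0‖ ^ 2 + ‖z 1‖ ^ 2 := fun z => by
    rw [EuclideanSpace.norm_sq_eq, Fin.sum_univ_two]
  have hball : ∀ z : UnitBall 2, monomialMap a C z ∈
      Metric.ball (0 : EuclideanSpace ℂ (Fin f.support.card)) 1 := by
    intro z
    have hz := mem_ball_zero_iff.1 z.2
    rw [← sq_lt_one_iff₀ (norm_nonneg _), hnorm] at hz
    rw [mem_ball_zero_iff, ← sq_lt_one_iff₀ (norm_nonneg _), norm_sq_monomialMap, hf]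
    exact (eval_le_of_linear_dvd hpos h0 hdvd (fun j => by positivity) hz.le).trans_lt hz
  refine ⟨fun z => ⟨monomialMap a C z, hball z⟩,
    isProperMap_of_norm_eq_one continuous_monomialMap (fun z => rfl) ?_,
    fun i => monomial (a i) (C i), fun i => ⟨a i, C i, rfl⟩, fun z i => rfl, hdeg⟩
  intro z hz
  rw [← sq_eq_sq₀ (norm_nonneg _) zero_le_one, norm_sq_monomialMap, hf, one_pow]
  obtain ⟨q, hq⟩ := hdvd
  have := congrArg (eval fun j => ‖z j‖ ^ 2) hq
  have hs : ‖z 0‖ ^ 2 + ‖z 1‖ ^ 2 = 1 := by rw [← hnorm, hz, one_pow]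
  simp only [map_sub, map_one, map_mul, map_add, eval_X, hs] at this
  linarith

end MonomialMaps

/-! ### The four statements together -/

theorem mainTheorem7 :
    -- the degree estimate for proper monomial maps from `B_2` to `B_k`
    (∀ (k d : ℕ) (φ : UnitBall 2 → UnitBall k),
      IsProperMap φ → IsMonomialMapOfDegree φ d → (d : ℤ) ≤ 2 * (k : ℤ) - 3) ∧
    -- its sharpness, in every target dimension `k ≥ 2`
    (∀ k : ℕ, 2 ≤ k → ∃ (d : ℕ) (φ : UnitBall 2 → UnitBall k),
      IsProperMap φ ∧ IsMonomialMapOfDegree φ d ∧ (d : ℤ) = 2 * (k : ℤ) - 3) ∧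
    -- the homogeneous form
    (∀ (d : ℕ) (p : MvPolynomial (Fin 3) ℝ),
      IsHomogForm d p → ((d : ℝ) + 5) / 2 ≤ (monomialRank p : ℝ)) ∧
    -- its sharpness, in every odd degree
    (∀ d : ℕ, Odd d → ∃ p : MvPolynomial (Fin 3) ℝ,
      IsHomogForm d p ∧ (monomialRank p : ℝ) = ((d : ℝ) + 5) / 2) := by
  refine ⟨fun k d φ hprop hφ => ?_, fun k hk => ?_, fun d p hp => ?_, fun d hd => ?_⟩
  · have := degree_add_three_le_of_isProperMap hprop hφ
    omega
  · have hodd : Odd (2 * k - 3) := ⟨k - 2, by omega⟩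
    have hp := isHomogForm_sharpPoly hodd
    have hcard := two_mul_card_support_tildePoly_sharpPoly hodd
    have hk' : (tildePoly (sharpPoly (2 * k - 3))).support.card = k := by omega
    obtain ⟨φ, hφ, hdeg⟩ := exists_isProperMap_of_linear_dvd hp.coeff_nonneg
      (coeff_zero_tildePoly hp) (linear_dvd_tildePoly_sub_one hp)
    rw [hp.totalDegree_tilde] at hdeg
    -- The type of φ depends on the support size, so φ must be generalized before that size is
    -- rewritten to k.
    revert φ
    rw [hk']
    intro φ hφ hdeg
    exact ⟨2 * k - 3, φ, hφ, hdeg, by omega⟩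
  · have h : ((d + 5 : ℕ) : ℝ) ≤ ((2 * monomialRank p : ℕ) : ℝ) := Nat.cast_le.2 hp.add_five_le
    push_cast at h
    linarith
  · refine ⟨sharpPoly d, isHomogForm_sharpPoly hd, ?_⟩
    have h : ((2 * monomialRank (sharpPoly d) : ℕ) : ℝ) = ((d + 5 : ℕ) : ℝ) :=
      congrArg Nat.cast (two_mul_monomialRank_sharpPoly hd)
    push_cast at h
    linarith
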